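/- Let $\rho$ and $\mu$ be Borel probability measures on $\mathbb{R}^d$, let $c(x,y)=\|x-y\|^2$, and consider the dual problem $$\max\Big\{\int \phi\,\mathrm{d}\rho+\int\psi\,\mathrm{d}\mu \;:\; \phi\in L^1(\rho),\ \psi\in L^1(\mu),\ \phi(x)+\psi(y)\le c(x,y)\ \text{for all } x,y\in\mathbb{R}^d\Big\},$$ where $\phi,\psi:\mathbb{R}^d\to[-\infty,\infty)$. The supports of $\rho$ and $\mu$ may be unbounded. Suppose that for any $x_0,x_1\in\operatorname{supp}\rho$ there is a Lipschitz curve $\omega:[0,1]\to\operatorname{supp}\rho$ with $\omega(0)=x_0$, $\omega(1)=x_1$ and $$\omega(t)\in\operatorname{int}(\operatorname{conv}\operatorname{supp}\rho)\quad\text{for all } t\in[0,1].$$ Then optimisers of the dual problem are unique up to a constant: if $(\phi_0,\psi_0)$ and $(\phi_1,\psi_1)$ are optimisers, there is $a\in\mathbb{R}$ such that $\phi_1=\phi_0+a$ $\rho$-almost everywhere and $\psi_1=\psi_0-a$ $\mu$-almost everywhere. Moreover, if $\phi_0$ and $\phi_1$ are both $c$-concave (each is of the form $x\mapsto\inf_{y}\,[c(x,y)-\chi(y)]$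 for some $\chi:\mathbb{R}^d\to[-\infty,+\infty]$), then $\phi_1(x)=\phi_0(x)+a$ for every $x\in\operatorname{supp}\rho$. -/

import Mathlib

open MeasureTheory Set
open scoped NNReal

namespace OT

/-- The quadratic cost `c(x, y) = ‖x - y‖²`. -/
def quadCost {E : Type*} [NormedAddCommGroup E] (x y : E) : ℝ := ‖x - y‖ ^ 2

/-- The function `f`, with values in the extended reals, represents an element of `L¹(ν)`:
it is finite `ν`-almost everywhere and its real part is integrable. -/
def IsL1 {X : Type*} [MeasurableSpace X] (ν : Measure X) (f : X → EReal) : Prop :=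
  (∀ᵐ x ∂ν, f x ≠ ⊥ ∧ f x ≠ ⊤) ∧ Integrable (fun x => (f x).toReal) ν

/-- The pair `(φ, ψ)` is admissible for the Kantorovich dual problem with cost `c`:
`φ ∈ L¹(ρ)`, `ψ ∈ L¹(μ)` and `φ(x) + ψ(y) ≤ c(x, y)` for all `x` and `y`.
The value `-∞` is allowed on null sets. The value `+∞` is never taken when `ρ, μ ≠ 0`: each of
the two functions is finite somewhere, and the constraint then bounds the other one from above. -/
structure IsDualAdmissible {X Y : Type*} [MeasurableSpace X] [MeasurableSpace Y]
    (ρ : Measure X) (μ : Measure Y) (c : X → Y → ℝ) (φ : X → EReal) (ψ : Y → EReal) : Prop where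
  left_mem : IsL1 ρ φ
  right_mem : IsL1 μ ψ
  add_le : ∀ x y, φ x + ψ y ≤ (c x y : EReal)

/-- The objective `∫ φ dρ + ∫ ψ dμ` of the dual problem. -/
noncomputable def dualValue {X Y : Type*} [MeasurableSpace X] [MeasurableSpace Y]
    (ρ : Measure X) (μ : Measure Y) (φ : X → EReal) (ψ : Y → EReal) : ℝ :=
  ∫ x, (φ x).toReal ∂ρ + ∫ y, (ψ y).toReal ∂μ

/-- The pair `(φ, ψ)` is an optimiser of the dual problem: it is admissible, and it maximises the
objective among all admissible pairs. -/
def IsDualOptimal {X Y : Type*} [MeasurableSpace X] [MeasurableSpace Y]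
    (ρ : Measure X) (μ : Measure Y) (c : X → Y → ℝ) (φ : X → EReal) (ψ : Y → EReal) : Prop :=
  IsDualAdmissible ρ μ c φ ψ ∧
    ∀ (φ' : X → EReal) (ψ' : Y → EReal), IsDualAdmissible ρ μ c φ' ψ' →
      dualValue ρ μ φ' ψ' ≤ dualValue ρ μ φ ψ

/-- The `c`-transform `ψᶜ(x) = inf_y c(x, y) - ψ(y)`. -/
noncomputable def cTransform {X Y : Type*} (c : X → Y → ℝ) (ψ : Y → EReal) (x : X) : EReal :=
  ⨅ y, ((c x y : EReal) - ψ y)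

/-- A function on `X` is `c`-concave if it is the `c`-transform of some function on `Y`. -/
def IsCConcave {X Y : Type*} (c : X → Y → ℝ) (φ : X → EReal) : Prop :=
  ∃ χ : Y → EReal, φ = cTransform c χ

/-- The points `x₀` and `x₁` are joined by a Lipschitz curve `ω : [0, 1] → S`. -/
def LipschitzJoinedIn {E : Type*} [PseudoEMetricSpace E] (S : Set E) (x₀ x₁ : E) : Prop :=
  ∃ (K : ℝ≥0) (ω : ℝ → E), LipschitzOnWith K ω (Icc 0 1) ∧ ω 0 = x₀ ∧ ω 1 = x₁ ∧
    ∀ t ∈ Icc (0 : ℝ) 1, ω t ∈ S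

end OT

/-! By conjugation, each optimiser may be taken to be a pair `(ψᵢᶜ, ψᵢ)` with `ψᵢ` upper
semicontinuous. Let `ψ` be the average of `ψ₀` and `ψ₁`. The average of two optimisers is again
optimal, so `ψᶜ` equals the average of `ψ₀ᶜ` and `ψ₁ᶜ` `ρ`-almost everywhere
(`IsDualOptimal.ae_eq_cTransform`), and by continuity on all of the support.

In the interior of the convex hull of the support the infimum defining `ψᶜ(x)` is attained at some
`y` (`exists_cTransform_eq`). At such a `y` both constraints `ψᵢᶜ(x) + ψᵢ(y) ≤ c(x, y)` are
equalities, so `2y` is a subgradient at `x` of both convex potentials `uᵢ = ‖·‖² - ψᵢᶜ`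
(`common_subgradient`).

Along a Lipschitz curve `ω` in the support, `uᵢ ∘ ω` is Lipschitz, and at almost every time both
derivatives equal `⟪ω', 2y⟫`. Hence `u₀ - u₁` is constant (`eq_of_lipschitzJoinedIn`). The `uᵢ` need
not be differentiable at any point of the curve. -/

namespace OT

/-! ### General `c`-transforms. -/

section CTransform

variable {X Y : Type*} {c : X → Y → ℝ} {ψ : Y → EReal}

theorem le_cTransform_iff {a : EReal} {x : X} :
    a ≤ cTransform c ψ x ↔ ∀ y, a + ψ y ≤ (c x y : EReal) := by
  simp only [cTransform, le_iInf_iff]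
  exact forall_congr' fun y => EReal.le_sub_iff_add_le (.inr (EReal.coe_ne_bot _))
    (.inr (EReal.coe_ne_top _))

theorem cTransform_add_le (x : X) (y : Y) : cTransform c ψ x + ψ y ≤ (c x y : EReal) :=
  le_cTransform_iff.1 le_rfl y

theorem cTransform_ne_top {y : Y} (hy : ψ y ≠ ⊥) (x : X) : cTransform c ψ x ≠ ⊤ := by
  intro h
  have := cTransform_add_le (c := c) (ψ := ψ) x y
  rw [h, EReal.top_add_of_ne_bot hy] at this
  exact EReal.coe_ne_top _ (top_le_iff.1 this)

theorem cTransform_antitone {ψ' : Y → EReal} (h : ∀ y, ψ y ≤ ψ' y) (x : X) :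
    cTransform c ψ' x ≤ cTransform c ψ x :=
  le_cTransform_iff.2 fun y => (add_le_add_right (h y) _).trans (cTransform_add_le x y)

end CTransform

/-! ### Transforms for the quadratic cost. -/

section Normed

variable {E : Type*} [NormedAddCommGroup E]

theorem quadCost_comm (x y : E) : quadCost x y = quadCost y x := by
  simp [quadCost, norm_sub_rev]

theorem IsCConcave.cTransform_cTransform {φ : E → EReal} (h : IsCConcave (quadCost (E := E)) φ) :
    cTransform quadCost (cTransform quadCost φ) = φ := by
  obtain ⟨χ, rfl⟩ := h
  funext x
  refine le_antisymm (cTransform_antitone (fun y => ?_) x) ?_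
  · refine le_cTransform_iff.2 fun x => ?_
    rw [add_comm, quadCost_comm]
    exact cTransform_add_le x y
  · refine le_cTransform_iff.2 fun y => ?_
    rw [add_comm, quadCost_comm]
    exact cTransform_add_le y x

theorem upperSemicontinuous_cTransform (ψ : E → EReal) :
    UpperSemicontinuous (cTransform quadCost ψ) := by
  refine upperSemicontinuous_iInf fun y => Continuous.upperSemicontinuous ?_
  have hc : Continuous fun x : E => quadCost x y := by unfold quadCost; fun_prop
  induction ψ y with
  | bot => simpa using continuous_const
  | top => simpa using continuous_const
  | coe r =>
    simp only [← EReal.coe_sub]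
    exact continuous_coe_real_ereal.comp (hc.sub continuous_const)

theorem cTransform_sub_const_le (φ : E → EReal) (a : ℝ) (y : E) :
    cTransform quadCost φ y - a ≤ cTransform quadCost (fun x => φ x + a) y := by
  refine le_cTransform_iff.2 fun x => le_trans (le_of_eq ?_)
    (cTransform_add_le (c := quadCost) (ψ := φ) y x)
  generalize cTransform quadCost φ y = p
  generalize φ x = q
  rw [sub_eq_add_neg, add_comm q, ← add_assoc, add_assoc p, ← EReal.coe_neg, ← EReal.coe_add]
  simp

theorem cTransform_add_const (φ : E → EReal) (a : ℝ) (y : E) :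
    cTransform quadCost (fun x => φ x + a) y = cTransform quadCost φ y - a := by
  refine le_antisymm ?_ (cTransform_sub_const_le φ a y)
  have h := cTransform_sub_const_le (fun x => φ x + a) (-a) y
  simp only [add_assoc, ← EReal.coe_add, add_neg_cancel, EReal.coe_zero, add_zero] at h
  refine (EReal.le_sub_iff_add_le (.inl (EReal.coe_ne_bot _)) (.inl (EReal.coe_ne_top _))).2 ?_
  simpa [sub_eq_add_neg] using h

/-! ### Convex potentials, attainment of the infimum, and rigidity along curves. -/

variable [InnerProductSpace ℝ E]

/-- The function `u = ‖·‖² - ψᶜ`, which is convex on the set where `ψᶜ > -∞`. -/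
noncomputable def quadPotential (ψ : E → EReal) (x : E) : ℝ :=
  ‖x‖ ^ 2 - (cTransform quadCost ψ x).toReal

theorem quadCost_convex_combination {a b : ℝ} (hab : a + b = 1) (x z y : E) :
    quadCost (a • x + b • z) y =
      a * quadCost x y + b * quadCost z y - a * b * ‖x - z‖ ^ 2 := by
  have h1 : a • x + b • z - y = a • (x - y) + b • (z - y) := by
    rw [smul_sub, smul_sub, sub_add_sub_comm, ← add_smul, hab, one_smul]
  have h2 : x - z = (x - y) - (z - y) := by abel
  obtain rfl : b = 1 - a := by linarith
  unfold quadCost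
  rw [h1, h2, norm_add_sq_real, norm_sub_sq_real (x - y), norm_smul, norm_smul, real_inner_smul_left,
    real_inner_smul_right, mul_pow, mul_pow, Real.norm_eq_abs, Real.norm_eq_abs, sq_abs, sq_abs]
  ring

/-- Each `‖·‖² - c(·, y)` is affine, which makes `‖·‖² - ψᶜ` convex. Real lower bounds `r`, `s` keep
`EReal` arithmetic out of the inequality. -/
theorem quadCost_le_cTransform_convex_combination {ψ : E → EReal} {a b r s : ℝ} (ha : 0 ≤ a)
    (hb : 0 ≤ b) (hab : a + b = 1) {x z : E} (hr : (r : EReal) ≤ cTransform quadCost ψ x)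
    (hs : (s : EReal) ≤ cTransform quadCost ψ z) :
    ((a * r + b * s - a * b * ‖x - z‖ ^ 2 : ℝ) : EReal) ≤
      cTransform quadCost ψ (a • x + b • z) := by
  refine le_cTransform_iff.2 fun y => ?_
  have h1 := le_cTransform_iff.1 hr y
  have h2 := le_cTransform_iff.1 hs y
  rw [quadCost_convex_combination hab]
  generalize ψ y = q at h1 h2 ⊢
  induction q with
  | bot => simp
  | top => simp at h1
  | coe p =>
    norm_cast at h1 h2 ⊢
    have : p = a * p + b * p := by rw [← add_mul, hab, one_mul]
    nlinarith [mul_le_mul_of_nonneg_left h1 ha, mul_le_mul_of_nonneg_left h2 hb]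

theorem convexOn_quadPotential {ψ : E → EReal} (hψ : ∃ y, ψ y ≠ ⊥) :
    ConvexOn ℝ {x | cTransform quadCost ψ x ≠ ⊥} (quadPotential ψ) := by
  obtain ⟨y₀, hy₀⟩ := hψ
  have key : ∀ x, cTransform quadCost ψ x ≠ ⊥ →
      (((cTransform quadCost ψ x).toReal : ℝ) : EReal) = cTransform quadCost ψ x := fun x hx =>
    EReal.coe_toReal (cTransform_ne_top hy₀ x) hx
  have main : ∀ x, cTransform quadCost ψ x ≠ ⊥ → ∀ z, cTransform quadCost ψ z ≠ ⊥ →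
      ∀ a b : ℝ, 0 ≤ a → 0 ≤ b → a + b = 1 → _ := fun x hx z hz a b ha hb hab =>
    quadCost_le_cTransform_convex_combination ha hb hab (key x hx).le (key z hz).le
  have conv : Convex ℝ {x | cTransform quadCost ψ x ≠ ⊥} := by
    intro x hx z hz a b ha hb hab h
    have := main x hx z hz a b ha hb hab
    rw [h] at this
    exact EReal.coe_ne_bot _ (le_bot_iff.1 this)
  refine ⟨conv, fun x hx z hz a b ha hb hab => ?_⟩
  have h1 := main x hx z hz a b ha hb hab
  rw [← key _ (conv hx hz ha hb hab), EReal.coe_le_coe_iff] at h1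
  have h2 := quadCost_convex_combination hab x z 0
  simp only [quadCost, sub_zero] at h2
  simp only [quadPotential, h2, smul_eq_mul]
  linarith

/-- The support lies only in `closure D`, but a convex set with nonempty interior has the same
interior as its closure. Nonemptiness is read off the affine span, which is closed in finite
dimension. -/
theorem interior_convexHull_support_subset [FiniteDimensional ℝ E] [MeasurableSpace E]
    (ρ : Measure E) {D : Set E} (hD : Convex ℝ D) (h : ∀ᵐ x ∂ρ, x ∈ D) :
    interior (convexHull ℝ ρ.support) ⊆ interior D := by
  have h1 : convexHull ℝ ρ.support ⊆ closure D :=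
    convexHull_min (Measure.support_subset_of_isClosed isClosed_closure
      (Filter.mem_of_superset h subset_closure)) hD.closure
  intro x hx
  have h2 : x ∈ interior (closure D) := interior_mono h1 hx
  have h3 : (interior D).Nonempty := by
    rw [hD.interior_nonempty_iff_affineSpan_eq_top]
    have h4 := hD.closure.interior_nonempty_iff_affineSpan_eq_top.1 ⟨x, h2⟩
    refine top_le_iff.1 (h4 ▸ affineSpan_le.2 ?_)
    exact closure_minimal (subset_affineSpan ℝ D) (AffineSubspace.closed_of_finiteDimensional _)
  rwa [hD.interior_closure_eq_interior_of_nonempty_interior h3] at h2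

/-- The potential is bounded by some `M` on a ball of radius `r` about `x`. Testing it at `x + r y /
‖y‖` shows that `c(x, y) - ψ(y)` grows at least like `2r‖y‖`, so the infimum is one over a compact
ball. -/
theorem exists_cTransform_eq [FiniteDimensional ℝ E] {ψ : E → EReal}
    (hψ : ∃ y, ψ y ≠ ⊥) (husc : UpperSemicontinuous ψ) {x : E}
    (hx : x ∈ interior {x | cTransform quadCost ψ x ≠ ⊥}) :
    ∃ y, cTransform quadCost ψ x = (quadCost x y : EReal) - ψ y := by
  have hconv := convexOn_quadPotential hψ
  obtain ⟨y₀, hy₀⟩ := hψ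
  have key : ∀ x, cTransform quadCost ψ x ≠ ⊥ →
      (((cTransform quadCost ψ x).toReal : ℝ) : EReal) = cTransform quadCost ψ x := fun x hx =>
    EReal.coe_toReal (cTransform_ne_top hy₀ x) hx
  have hcont : ContinuousAt (quadPotential ψ) x :=
    hconv.continuousOn_interior.continuousAt (isOpen_interior.mem_nhds hx)
  set M := quadPotential ψ x + 1 with hM
  have hev : ∀ᶠ z in nhds x, cTransform quadCost ψ z ≠ ⊥ ∧ quadPotential ψ z < M :=
    Filter.Eventually.and (mem_interior_iff_mem_nhds.1 hx) (hcont.eventually_lt_const (by linarith))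
  obtain ⟨r, hr, hball⟩ := Metric.nhds_basis_closedBall.mem_iff.1 hev
  set t := (cTransform quadCost ψ x).toReal with ht
  have hxt : cTransform quadCost ψ x = (t : EReal) := (key x (interior_subset hx)).symm
  have coer : ∀ y : E, ((‖x‖ ^ 2 + 2 * r * ‖y‖ - M : ℝ) : EReal) ≤ (quadCost x y : EReal) - ψ y := by
    intro y
    -- For `y = 0` the quotient is `0` and the test point is `x` itself.
    have hz : x + (r / ‖y‖) • y ∈ Metric.closedBall x r := by
      rw [mem_closedBall_iff_norm, add_sub_cancel_left, norm_smul, norm_div, norm_norm,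
        Real.norm_of_nonneg hr.le]
      rcases eq_or_ne ‖y‖ 0 with h | h
      · simp [h, hr.le]
      · rw [div_mul_cancel₀ _ h]
    obtain ⟨h1, h2⟩ := hball hz
    have h3 := cTransform_add_le (c := quadCost) (ψ := ψ) (x + (r / ‖y‖) • y) y
    rw [← key _ h1] at h3
    simp only [quadPotential] at h2
    refine (EReal.le_sub_iff_add_le (.inr (EReal.coe_ne_bot _)) (.inr (EReal.coe_ne_top _))).2 ?_
    have hin : (r / ‖y‖) * ‖y‖ ^ 2 = r * ‖y‖ := by
      rcases eq_or_ne ‖y‖ 0 with h | h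
      · simp [h]
      · field_simp
    have hq : quadCost (x + (r / ‖y‖) • y) y = ‖x + (r / ‖y‖) • y‖ ^ 2 - 2 * inner ℝ x y
        - 2 * (r * ‖y‖) + ‖y‖ ^ 2 := by
      rw [quadCost, norm_sub_sq_real, inner_add_left, real_inner_smul_left,
        real_inner_self_eq_norm_sq, hin]
      ring
    rw [hq] at h3
    rw [quadCost, norm_sub_sq_real]
    generalize ψ y = q at h3 ⊢
    induction q with
    | bot => simp
    | top =>
      rw [EReal.coe_add_top] at h3
      exact absurd (top_le_iff.1 h3) (EReal.coe_ne_top _)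
    | coe p =>
      norm_cast at h3 ⊢
      linarith
  -- Outside the ball of radius `R`, the bound `coer` is at least `t + 1`, above the infimum `t`.
  set R := |(t + 1 + M - ‖x‖ ^ 2) / (2 * r)| with hR
  have hlsc : LowerSemicontinuous fun y => (quadCost x y : EReal) - ψ y := by
    have hc : Continuous fun y : E => ((quadCost x y : ℝ) : EReal) :=
      continuous_coe_real_ereal.comp (by unfold quadCost; fun_prop)
    have hn : LowerSemicontinuous fun y => -ψ y :=
      continuous_neg.comp_upperSemicontinuous_antitone husc fun a b h => EReal.neg_le_neg_iff.2 h
    exact hc.lowerSemicontinuous.add' hn fun y =>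
      EReal.continuousAt_add (.inl (EReal.coe_ne_top _)) (.inl (EReal.coe_ne_bot _))
  obtain ⟨y, -, hy⟩ := (hlsc.lowerSemicontinuousOn (Metric.closedBall 0 R)).exists_isMinOn
    ⟨0, by simp [hR]⟩ (isCompact_closedBall (0 : E) R)
  refine ⟨y, le_antisymm (iInf_le _ y) (not_lt.1 fun hlt => ?_)⟩
  have hmin : min ((quadCost x y : EReal) - ψ y) ((t + 1 : ℝ) : EReal) ≤
      cTransform quadCost ψ x := by
    refine le_iInf fun y' => ?_
    by_cases hy' : y' ∈ Metric.closedBall (0 : E) R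
    · exact (min_le_left _ _).trans (hy hy')
    · refine (min_le_right _ _).trans (le_trans ?_ (coer y'))
      rw [EReal.coe_le_coe_iff]
      have h1 : (t + 1 + M - ‖x‖ ^ 2) / (2 * r) ≤ ‖y'‖ := by
        rw [mem_closedBall_zero_iff, not_le] at hy'
        exact (le_abs_self _).trans hy'.le
      rw [div_le_iff₀ (by positivity)] at h1
      linarith
  refine absurd hmin (not_le.2 (lt_min hlt ?_))
  rw [hxt, EReal.coe_lt_coe_iff]
  linarith

theorem eq_of_lipschitzJoinedIn [FiniteDimensional ℝ E] {U S : Set E} {u₀ u₁ : E → ℝ}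
    (h₀ : LocallyLipschitzOn U u₀) (h₁ : LocallyLipschitzOn U u₁) (hSU : S ⊆ U)
    (hsub : ∀ x ∈ S, ∃ y, ∀ z ∈ S, u₀ x + inner ℝ (z - x) y ≤ u₀ z ∧
      u₁ x + inner ℝ (z - x) y ≤ u₁ z) {x₀ x₁ : E} (h : LipschitzJoinedIn S x₀ x₁) :
    u₀ x₀ - u₁ x₀ = u₀ x₁ - u₁ x₁ := by
  obtain ⟨K, ω, hω, rfl, rfl, hS⟩ := h
  have lip : ∀ u : E → ℝ, LocallyLipschitzOn U u →
      ∃ K, LipschitzOnWith K (u ∘ ω) (uIcc 0 1) := by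
    intro u hu
    rw [uIcc_of_le zero_le_one]
    obtain ⟨K', hK'⟩ := LocallyLipschitzOn.exists_lipschitzOnWith_of_compact
      (isCompact_Icc.image_of_continuousOn hω.continuousOn)
      (hu.mono ((image_subset_iff.2 hS).trans hSU))
    exact ⟨_, hK'.comp hω (mapsTo_image _ _)⟩
  obtain ⟨K₀, hK₀⟩ := lip u₀ h₀
  obtain ⟨K₁, hK₁⟩ := lip u₁ h₁
  have hac := hK₀.absolutelyContinuousOnInterval.sub hK₁.absolutelyContinuousOnInterval
  have hd0 := hK₀.absolutelyContinuousOnInterval.ae_differentiableAt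
  have hd1 := hK₁.absolutelyContinuousOnInterval.ae_differentiableAt
  rw [← uIcc_of_le (zero_le_one (α := ℝ))] at hω
  have hdω := hω.absolutelyContinuousOnInterval.boundedVariationOn.ae_differentiableAt_of_mem_uIcc
  obtain ⟨C, hC⟩ := hac.const_of_ae_hasDerivAt_zero (by
    -- Endpoints are discarded because `ω` is controlled only on `[0, 1]`, which must be a
    -- neighbourhood of `t`.
    have e₀ : ∀ᵐ t : ℝ, t ≠ 0 := by simp [ae_iff, measure_singleton]
    have e₁ : ∀ᵐ t : ℝ, t ≠ 1 := by simp [ae_iff, measure_singleton]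
    filter_upwards [hd0, hd1, hdω, e₀, e₁] with t h0 h1 h2 ht0 ht1 ht
    specialize h0 ht; specialize h1 ht; specialize h2 ht
    rw [uIcc_of_le zero_le_one] at ht
    have hnhds : Icc (0 : ℝ) 1 ∈ nhds t :=
      Icc_mem_nhds (lt_of_le_of_ne ht.1 ht0.symm) (lt_of_le_of_ne ht.2 ht1)
    obtain ⟨y, hy⟩ := hsub _ (hS t ht)
    have hl : HasDerivAt (fun s => inner ℝ (ω s - ω t) y) (inner ℝ (deriv ω t) y) t := by
      simpa using (h2.hasDerivAt.sub_const (ω t)).inner ℝ (hasDerivAt_const t y)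
    have aux : ∀ u : E → ℝ, (∀ z ∈ S, u (ω t) + inner ℝ (z - ω t) y ≤ u z) →
        DifferentiableAt ℝ (u ∘ ω) t → HasDerivAt (u ∘ ω) (inner ℝ (deriv ω t) y) t := by
      intro u hu hd
      -- The subgradient's affine function touches `u` from below at `ω t`, so a derivative of `u ∘
      -- ω` there is forced.
      have hmin : IsLocalMin (fun s => (u ∘ ω) s - inner ℝ (ω s - ω t) y) t := by
        filter_upwards [hnhds] with s hs
        have := hu _ (hS s hs)
        simp only [Function.comp, sub_self, inner_zero_left, sub_zero]
        linarith
      have := hmin.hasDerivAt_eq_zero (hd.hasDerivAt.sub hl)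
      rw [← sub_eq_zero.1 this]
      exact hd.hasDerivAt
    have := (aux u₀ (fun z hz => (hy z hz).1) h0).sub (aux u₁ (fun z hz => (hy z hz).2) h1)
    rwa [sub_self] at this)
  have a0 := hC 0 (by simp)
  have a1 := hC 1 (by simp)
  simp only [Pi.sub_apply, Function.comp] at a0 a1
  rw [a0, a1]

end Normed

/-! ### Averages of extended reals. -/

section Average

/-- The average of two extended reals. -/
noncomputable def erealAverage (a b : EReal) : EReal := ((1 / 2 : ℝ) : EReal) * (a + b)

@[simp] theorem erealAverage_coe (a b : ℝ) :
    erealAverage a b = (((a + b) / 2 : ℝ) : EReal) := by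
  rw [erealAverage, ← EReal.coe_add, ← EReal.coe_mul]
  congr 1
  ring

@[simp] theorem erealAverage_bot_left (b : EReal) : erealAverage ⊥ b = ⊥ := by
  rw [erealAverage, EReal.bot_add, EReal.coe_mul_bot_of_pos (by norm_num)]

@[simp] theorem erealAverage_bot_right (a : EReal) : erealAverage a ⊥ = ⊥ := by
  rw [erealAverage, EReal.add_bot, EReal.coe_mul_bot_of_pos (by norm_num)]

theorem erealAverage_add_le {a₀ a₁ b₀ b₁ : EReal} {r : ℝ} (ha₀ : a₀ ≠ ⊤) (ha₁ : a₁ ≠ ⊤)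
    (hb₀ : b₀ ≠ ⊤) (hb₁ : b₁ ≠ ⊤) (h₀ : a₀ + b₀ ≤ r) (h₁ : a₁ + b₁ ≤ r) :
    erealAverage a₀ a₁ + erealAverage b₀ b₁ ≤ r := by
  induction a₀ with
  | top => exact absurd rfl ha₀
  | bot => simp
  | coe a₀ =>
  induction a₁ with
  | top => exact absurd rfl ha₁
  | bot => simp
  | coe a₁ =>
  induction b₀ with
  | top => exact absurd rfl hb₀
  | bot => simp
  | coe b₀ =>
  induction b₁ with
  | top => exact absurd rfl hb₁
  | bot => simp
  | coe b₁ =>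
  rw [erealAverage_coe, erealAverage_coe]
  norm_cast at h₀ h₁ ⊢
  linarith

theorem upperSemicontinuous_erealAverage {X : Type*} [TopologicalSpace X] {f g : X → EReal}
    (hf : UpperSemicontinuous f) (hg : UpperSemicontinuous g) (hf' : ∀ x, f x ≠ ⊤)
    (hg' : ∀ x, g x ≠ ⊤) : UpperSemicontinuous fun x => erealAverage (f x) (g x) := by
  have hadd : UpperSemicontinuous fun x => f x + g x :=
    hf.add' hg fun x => EReal.continuousAt_add (.inl (hf' x)) (.inr (hg' x))
  have hc : Continuous fun a : EReal => ((1 / 2 : ℝ) : EReal) * a :=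
    continuous_iff_continuousAt.2 fun a => EReal.Tendsto.const_mul Filter.tendsto_id
      (.inl (EReal.coe_ne_bot _)) (.inl (EReal.coe_ne_top _))
  exact hc.comp_upperSemicontinuous hadd fun a b hab =>
    mul_le_mul_of_nonneg_left hab (EReal.coe_nonneg.2 (by norm_num))

end Average

/-- If the infimum defining `((ψ₀ + ψ₁) / 2)ᶜ` is attained at `x` and its value there is the average
of `ψ₀ᶜ` and `ψ₁ᶜ`, the minimiser gives a common subgradient at `x` of the two potentials. -/
theorem common_subgradient {E : Type*} [NormedAddCommGroup E] [InnerProductSpace ℝ E]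
    {ψ₀ ψ₁ : E → EReal} (hψ₀ : ∀ y, ψ₀ y ≠ ⊤) (hψ₁ : ∀ y, ψ₁ y ≠ ⊤) {S : Set E}
    (h₀ : ∀ z ∈ S, cTransform quadCost ψ₀ z ≠ ⊥ ∧ cTransform quadCost ψ₀ z ≠ ⊤)
    (h₁ : ∀ z ∈ S, cTransform quadCost ψ₁ z ≠ ⊥ ∧ cTransform quadCost ψ₁ z ≠ ⊤) {x y : E}
    (hx : x ∈ S)
    (hy : ((((cTransform quadCost ψ₀ x).toReal + (cTransform quadCost ψ₁ x).toReal) / 2 : ℝ) :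
      EReal) = (quadCost x y : EReal) - erealAverage (ψ₀ y) (ψ₁ y)) :
    ∀ z ∈ S, quadPotential ψ₀ x + inner ℝ (z - x) ((2 : ℝ) • y) ≤ quadPotential ψ₀ z ∧
      quadPotential ψ₁ x + inner ℝ (z - x) ((2 : ℝ) • y) ≤ quadPotential ψ₁ z := by
  have le₀ : ∀ z ∈ S, (((cTransform quadCost ψ₀ z).toReal : ℝ) : EReal) + ψ₀ y ≤
      (quadCost z y : EReal) := fun z hz => by
    rw [EReal.coe_toReal (h₀ z hz).2 (h₀ z hz).1]
    exact cTransform_add_le z y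
  have le₁ : ∀ z ∈ S, (((cTransform quadCost ψ₁ z).toReal : ℝ) : EReal) + ψ₁ y ≤
      (quadCost z y : EReal) := fun z hz => by
    rw [EReal.coe_toReal (h₁ z hz).2 (h₁ z hz).1]
    exact cTransform_add_le z y
  have hp₀ := hψ₀ y
  have hp₁ := hψ₁ y
  generalize ψ₀ y = p₀ at le₀ hy hp₀
  generalize ψ₁ y = p₁ at le₁ hy hp₁
  induction p₀ with
  | top => exact absurd rfl hp₀
  | bot =>
    rw [erealAverage_bot_left, EReal.coe_sub_bot] at hy
    exact absurd hy (EReal.coe_ne_top _)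
  | coe p₀ =>
  induction p₁ with
  | top => exact absurd rfl hp₁
  | bot =>
    rw [erealAverage_bot_right, EReal.coe_sub_bot] at hy
    exact absurd hy (EReal.coe_ne_top _)
  | coe p₁ =>
  rw [erealAverage_coe, ← EReal.coe_sub, EReal.coe_eq_coe_iff] at hy
  simp only [← EReal.coe_add, EReal.coe_le_coe_iff] at le₀ le₁
  intro z hz
  have a₀ := le₀ x hx
  have a₁ := le₁ x hx
  have b₀ := le₀ z hz
  have b₁ := le₁ z hz
  simp only [quadCost, norm_sub_sq_real] at hy a₀ a₁ b₀ b₁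
  simp only [quadPotential, inner_sub_left, real_inner_smul_right]
  -- By `hy`, the inequalities `a₀` and `a₁` sum to an equality, so each is one; subtracting them
  -- from `b₀` and `b₁` gives the claim.
  constructor <;> linarith

/-! ### Dual optimisers for a general cost. -/

section Dual

variable {X Y : Type*} [MeasurableSpace X] [MeasurableSpace Y] {ρ : Measure X} {μ : Measure Y}
  {c : X → Y → ℝ} {φ φ' φ₀ φ₁ : X → EReal} {ψ ψ' ψ₀ ψ₁ : Y → EReal}

theorem IsL1.exists_ne_bot [NeZero ρ] (h : IsL1 ρ φ) : ∃ x, φ x ≠ ⊥ :=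
  (h.1.mono fun _ hx => hx.1).exists

theorem IsL1.congr (h : IsL1 ρ φ) (hφ : φ' =ᵐ[ρ] φ) : IsL1 ρ φ' := by
  refine ⟨?_, h.2.congr ?_⟩
  · filter_upwards [h.1, hφ] with x hx hx'
    rwa [hx']
  · filter_upwards [hφ] with x hx
    rw [hx]

theorem IsDualAdmissible.left_ne_top [NeZero μ] (h : IsDualAdmissible ρ μ c φ ψ) (x : X) :
    φ x ≠ ⊤ := by
  obtain ⟨y, hy⟩ := h.right_mem.exists_ne_bot
  intro hx
  have := h.add_le x y
  rw [hx, EReal.top_add_of_ne_bot hy] at this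
  exact EReal.coe_ne_top _ (top_le_iff.1 this)

theorem IsDualAdmissible.right_ne_top [NeZero ρ] (h : IsDualAdmissible ρ μ c φ ψ) (y : Y) :
    ψ y ≠ ⊤ := by
  obtain ⟨x, hx⟩ := h.left_mem.exists_ne_bot
  intro hy
  have := h.add_le x y
  rw [hy, EReal.add_top_of_ne_bot hx] at this
  exact EReal.coe_ne_top _ (top_le_iff.1 this)

theorem IsDualOptimal.congr (h : IsDualOptimal ρ μ c φ ψ) (hφ : φ' =ᵐ[ρ] φ) (hψ : ψ' =ᵐ[μ] ψ)
    (hadd : ∀ x y, φ' x + ψ' y ≤ (c x y : EReal)) : IsDualOptimal ρ μ c φ' ψ' := by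
  have hv : dualValue ρ μ φ' ψ' = dualValue ρ μ φ ψ := by
    unfold dualValue
    congr 1
    · exact integral_congr_ae (hφ.mono fun x hx => by simp only [hx])
    · exact integral_congr_ae (hψ.mono fun x hx => by simp only [hx])
  exact ⟨⟨h.1.left_mem.congr hφ, h.1.right_mem.congr hψ, hadd⟩, fun f g hfg =>
    (h.2 f g hfg).trans hv.ge⟩

theorem IsL1.average (h₀ : IsL1 ρ φ₀) (h₁ : IsL1 ρ φ₁) :
    IsL1 ρ (fun x => erealAverage (φ₀ x) (φ₁ x)) ∧
      ∫ x, (erealAverage (φ₀ x) (φ₁ x)).toReal ∂ρ =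
        (∫ x, (φ₀ x).toReal ∂ρ + ∫ x, (φ₁ x).toReal ∂ρ) / 2 := by
  have h : ∀ᵐ x ∂ρ, erealAverage (φ₀ x) (φ₁ x) =
      ((((φ₀ x).toReal + (φ₁ x).toReal) / 2 : ℝ) : EReal) := by
    filter_upwards [h₀.1, h₁.1] with x hx₀ hx₁
    rw [← erealAverage_coe, EReal.coe_toReal hx₀.2 hx₀.1, EReal.coe_toReal hx₁.2 hx₁.1]
  have h' : (fun x => (erealAverage (φ₀ x) (φ₁ x)).toReal) =ᵐ[ρ]
      fun x => ((φ₀ x).toReal + (φ₁ x).toReal) / 2 := by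
    filter_upwards [h] with x hx
    rw [hx, EReal.toReal_coe]
  refine ⟨⟨?_, ((h₀.2.add h₁.2).div_const 2).congr h'.symm⟩, ?_⟩
  · filter_upwards [h] with x hx
    rw [hx]
    exact ⟨EReal.coe_ne_bot _, EReal.coe_ne_top _⟩
  · rw [integral_congr_ae h', integral_div, integral_add h₀.2 h₁.2]

theorem IsDualOptimal.average [NeZero ρ] [NeZero μ] (h₀ : IsDualOptimal ρ μ c φ₀ ψ₀)
    (h₁ : IsDualOptimal ρ μ c φ₁ ψ₁) :
    IsDualOptimal ρ μ c (fun x => erealAverage (φ₀ x) (φ₁ x))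
      (fun y => erealAverage (ψ₀ y) (ψ₁ y)) := by
  obtain ⟨hφ, hφi⟩ := h₀.1.left_mem.average h₁.1.left_mem
  obtain ⟨hψ, hψi⟩ := h₀.1.right_mem.average h₁.1.right_mem
  refine ⟨⟨hφ, hψ, fun x y => erealAverage_add_le (h₀.1.left_ne_top x) (h₁.1.left_ne_top x)
    (h₀.1.right_ne_top y) (h₁.1.right_ne_top y) (h₀.1.add_le x y) (h₁.1.add_le x y)⟩, ?_⟩
  intro f g hfg
  have e₀ := h₀.2 f g hfg
  have e₁ := h₁.2 f g hfg
  unfold dualValue at e₀ e₁ ⊢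
  rw [hφi, hψi]
  linarith

end Dual

/-! ### Conjugating optimisers for the quadratic cost. -/

section Quadratic

variable {E : Type*} [NormedAddCommGroup E] [MeasurableSpace E] {ρ μ : Measure E}
  {φ φ' φ₀ φ₁ ψ ψ' ψ₀ ψ₁ : E → EReal}

theorem IsDualAdmissible.symm (h : IsDualAdmissible ρ μ quadCost φ ψ) :
    IsDualAdmissible μ ρ quadCost ψ φ :=
  ⟨h.right_mem, h.left_mem, fun x y => by rw [add_comm, quadCost_comm]; exact h.add_le y x⟩

theorem IsDualOptimal.symm (h : IsDualOptimal ρ μ quadCost φ ψ) :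
    IsDualOptimal μ ρ quadCost ψ φ :=
  ⟨h.1.symm, fun f g hfg => by
    have := h.2 g f hfg.symm
    unfold dualValue at this ⊢
    linarith⟩

theorem IsDualOptimal.ae_eq_cTransform [OpensMeasurableSpace E] [IsFiniteMeasure ρ]
    (h : IsDualOptimal ρ μ quadCost φ ψ) : cTransform quadCost ψ =ᵐ[ρ] φ := by
  have hle : ∀ x, φ x ≤ cTransform quadCost ψ x := fun x => le_cTransform_iff.2 (h.1.add_le x)
  -- `ψᶜ ≥ φ` is not known to be integrable; truncating at `φ + 1` gives an admissible competitor.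
  -- Optimality forces `f = φ` almost everywhere, where the minimum cannot be `φ + 1`.
  set f : E → EReal := fun x => min (cTransform quadCost ψ x) (φ x + 1) with hf
  have hmeas : AEStronglyMeasurable (fun x => (f x).toReal) ρ := by
    have h1 : AEMeasurable (fun x => (min (cTransform quadCost ψ x)
        (((φ x).toReal + 1 : ℝ) : EReal)).toReal) ρ :=
      ((upperSemicontinuous_cTransform ψ).measurable.aemeasurable.min
        (h.1.left_mem.2.aemeasurable.add_const 1).coe_real_ereal).ereal_toReal
    refine (h1.congr ?_).aestronglyMeasurable
    filter_upwards [h.1.left_mem.1] with x hx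
    rw [EReal.coe_add, EReal.coe_toReal hx.2 hx.1, EReal.coe_one]
  have hbound : ∀ᵐ x ∂ρ, (f x ≠ ⊥ ∧ f x ≠ ⊤) ∧ (φ x).toReal ≤ (f x).toReal ∧
      (f x).toReal ≤ (φ x).toReal + 1 := by
    filter_upwards [h.1.left_mem.1] with x hx
    have hlo : φ x ≤ f x := le_min (hle x) (by
      simpa using add_le_add_right (zero_le_one (α := EReal)) (φ x))
    have hup : f x ≤ φ x + 1 := min_le_right _ _
    generalize f x = q at hlo hup
    obtain ⟨p, hp⟩ : ∃ p : ℝ, φ x = p := ⟨_, (EReal.coe_toReal hx.2 hx.1).symm⟩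
    rw [hp] at hlo hup ⊢
    rw [← EReal.coe_one, ← EReal.coe_add] at hup
    induction q with
    | bot => simp at hlo
    | top => exact absurd (top_le_iff.1 hup) (EReal.coe_ne_top _)
    | coe q =>
      rw [EReal.coe_le_coe_iff] at hlo hup
      simpa using ⟨hlo, hup⟩
  have hint : Integrable (fun x => (f x).toReal) ρ := by
    refine (h.1.left_mem.2.abs.add (integrable_const 1)).mono' hmeas ?_
    filter_upwards [hbound] with x hx
    rw [Real.norm_eq_abs, abs_le]
    simp only [Pi.add_apply]
    constructor
    · linarith [neg_abs_le (φ x).toReal, hx.2.1]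
    · linarith [le_abs_self (φ x).toReal, hx.2.2]
  have hadm : IsDualAdmissible ρ μ quadCost f ψ :=
    ⟨⟨hbound.mono fun x hx => hx.1, hint⟩, h.1.right_mem, fun x y =>
      (add_le_add_left (min_le_left _ _) _).trans (cTransform_add_le x y)⟩
  have hval := h.2 f ψ hadm
  unfold dualValue at hval
  have hae : ∀ᵐ x ∂ρ, (φ x).toReal ≤ (f x).toReal := hbound.mono fun x hx => hx.2.1
  have heq := (integral_eq_iff_of_ae_le h.1.left_mem.2 hint hae).1
    (le_antisymm (integral_mono_ae h.1.left_mem.2 hint hae) (by linarith))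
  filter_upwards [heq, hbound, h.1.left_mem.1] with x h1 h2 h3
  have h4 : f x = φ x := by
    rw [← EReal.coe_toReal h2.1.2 h2.1.1, ← h1, EReal.coe_toReal h3.2 h3.1]
  rcases min_choice (cTransform quadCost ψ x) (φ x + 1) with h5 | h5
  · rw [← h5]; exact h4
  · exfalso
    have h6 : φ x + 1 = φ x := h5.symm.trans h4
    rw [← EReal.coe_toReal h3.2 h3.1, ← EReal.coe_one, ← EReal.coe_add,
      EReal.coe_eq_coe_iff] at h6
    linarith

/-- An optimiser may be replaced by a pair of conjugate functions. -/
theorem IsDualOptimal.conjugate [OpensMeasurableSpace E] [IsFiniteMeasure ρ] [IsFiniteMeasure μ]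
    (h : IsDualOptimal ρ μ quadCost φ ψ) :
    cTransform quadCost φ =ᵐ[μ] ψ ∧ cTransform quadCost (cTransform quadCost φ) =ᵐ[ρ] φ ∧
      IsDualOptimal ρ μ quadCost (cTransform quadCost (cTransform quadCost φ))
        (cTransform quadCost φ) := by
  have h1 := h.symm.ae_eq_cTransform
  have h2 : IsDualOptimal ρ μ quadCost φ (cTransform quadCost φ) :=
    h.congr .rfl h1 fun x y => by
      rw [add_comm, quadCost_comm]
      exact cTransform_add_le y x
  have h3 := h2.ae_eq_cTransform
  exact ⟨h1, h3, h2.congr h3 .rfl fun x y => cTransform_add_le x y⟩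

theorem eqOn_support_of_ae_eq {U : Set E} (hU : IsOpen U) {f g : E → ℝ} (hf : ContinuousOn f U)
    (hg : ContinuousOn g U) (h : f =ᵐ[ρ] g) : EqOn f g (ρ.support ∩ U) := by
  intro x hx
  by_contra hne
  have h1 : ∀ᶠ z in nhds x, f z ≠ g z :=
    ((hf.continuousAt (hU.mem_nhds hx.2)).ne_iff_eventually_ne
      (hg.continuousAt (hU.mem_nhds hx.2))).1 hne
  exact ((Measure.mem_support_iff_forall x).1 hx.1 _ h1).ne' (ae_iff.1 h)

end Quadratic

/-! ### Uniqueness up to a constant. -/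

variable {E : Type*} [NormedAddCommGroup E] [InnerProductSpace ℝ E] [FiniteDimensional ℝ E]
  [MeasurableSpace E] [BorelSpace E] {ρ μ : Measure E} {φ φ₀ φ₁ ψ ψ₀ ψ₁ : E → EReal}

theorem exists_eq_add_const_of_cTransform [IsProbabilityMeasure ρ] [IsProbabilityMeasure μ]
    (hρ : ∀ x₀ ∈ ρ.support, ∀ x₁ ∈ ρ.support,
      LipschitzJoinedIn (ρ.support ∩ interior (convexHull ℝ ρ.support)) x₀ x₁)
    (h₀ : IsDualOptimal ρ μ quadCost (cTransform quadCost ψ₀) ψ₀)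
    (h₁ : IsDualOptimal ρ μ quadCost (cTransform quadCost ψ₁) ψ₁)
    (usc₀ : UpperSemicontinuous ψ₀) (usc₁ : UpperSemicontinuous ψ₁) :
    ∃ a : ℝ, ∀ x ∈ ρ.support,
      cTransform quadCost ψ₁ x = cTransform quadCost ψ₀ x + (a : EReal) := by
  -- Apply the hypothesis to a curve from `x` to itself.
  have hSU : ρ.support ⊆ interior (convexHull ℝ ρ.support) := fun x hx => by
    obtain ⟨K, ω, -, h0, -, hS⟩ := hρ x hx x hx
    exact h0 ▸ (hS 0 (by simp)).2
  have hρ' : ∀ x₀ ∈ ρ.support, ∀ x₁ ∈ ρ.support, LipschitzJoinedIn ρ.support x₀ x₁ := by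
    rwa [inter_eq_left.2 hSU] at hρ
  set U := interior (convexHull ℝ ρ.support)
  have hav := h₀.average h₁
  set ψ : E → EReal := fun y => erealAverage (ψ₀ y) (ψ₁ y) with hψ
  have hae := hav.ae_eq_cTransform
  have hUD : ∀ {χ : E → EReal}, (∃ y, χ y ≠ ⊥) → (∀ᵐ x ∂ρ, cTransform quadCost χ x ≠ ⊥) →
      U ⊆ interior {x | cTransform quadCost χ x ≠ ⊥} := fun hχ h =>
    interior_convexHull_support_subset ρ (convexOn_quadPotential hχ).1 h
  have ne₀ := h₀.1.right_mem.exists_ne_bot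
  have ne₁ := h₁.1.right_mem.exists_ne_bot
  have ne := hav.1.right_mem.exists_ne_bot
  have hU₀ := hUD ne₀ (h₀.1.left_mem.1.mono fun x hx => hx.1)
  have hU₁ := hUD ne₁ (h₁.1.left_mem.1.mono fun x hx => hx.1)
  have hU := hUD (χ := ψ) ne (by
    filter_upwards [hae, hav.1.left_mem.1] with x h1 h2
    rw [h1]
    exact h2.1)
  have lip₀ := (convexOn_quadPotential ne₀).locallyLipschitzOn_interior.mono hU₀
  have lip₁ := (convexOn_quadPotential ne₁).locallyLipschitzOn_interior.mono hU₁
  have hcont := (convexOn_quadPotential ne).continuousOn_interior.mono hU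
  have fin₀ : ∀ z ∈ ρ.support, cTransform quadCost ψ₀ z ≠ ⊥ ∧ cTransform quadCost ψ₀ z ≠ ⊤ :=
    fun z hz => ⟨interior_subset (hU₀ (hSU hz)), h₀.1.left_ne_top z⟩
  have fin₁ : ∀ z ∈ ρ.support, cTransform quadCost ψ₁ z ≠ ⊥ ∧ cTransform quadCost ψ₁ z ≠ ⊤ :=
    fun z hz => ⟨interior_subset (hU₁ (hSU hz)), h₁.1.left_ne_top z⟩
  have hpot : ∀ x ∈ ρ.support,
      quadPotential ψ x = (quadPotential ψ₀ x + quadPotential ψ₁ x) / 2 := by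
    intro x hx
    refine eqOn_support_of_ae_eq (ρ := ρ) isOpen_interior hcont
      (g := fun x => (quadPotential ψ₀ x + quadPotential ψ₁ x) / 2)
      ((lip₀.continuousOn.add lip₁.continuousOn).div_const 2) ?_ ⟨hx, hSU hx⟩
    filter_upwards [hae, h₀.1.left_mem.1, h₁.1.left_mem.1] with z hz hz₀ hz₁
    rw [← EReal.coe_toReal hz₀.2 hz₀.1, ← EReal.coe_toReal hz₁.2 hz₁.1, erealAverage_coe] at hz
    simp only [quadPotential, hz, EReal.toReal_coe]
    ring
  have hsub : ∀ x ∈ ρ.support, ∃ y, ∀ z ∈ ρ.support,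
      quadPotential ψ₀ x + inner ℝ (z - x) y ≤ quadPotential ψ₀ z ∧
      quadPotential ψ₁ x + inner ℝ (z - x) y ≤ quadPotential ψ₁ z := by
    intro x hx
    obtain ⟨y, hy⟩ := exists_cTransform_eq ne (upperSemicontinuous_erealAverage usc₀ usc₁
      h₀.1.right_ne_top h₁.1.right_ne_top) (hU (hSU hx))
    refine ⟨(2 : ℝ) • y, common_subgradient h₀.1.right_ne_top h₁.1.right_ne_top fin₀ fin₁ hx ?_⟩
    obtain ⟨y₀, hy₀⟩ := ne
    rw [← hy, ← EReal.coe_toReal (cTransform_ne_top hy₀ x) (interior_subset (hU (hSU hx))),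
      EReal.coe_eq_coe_iff]
    have := hpot x hx
    simp only [quadPotential] at this
    linarith
  obtain ⟨x₀, hx₀⟩ := ρ.nonempty_support (NeZero.ne ρ)
  refine ⟨quadPotential ψ₀ x₀ - quadPotential ψ₁ x₀, fun x hx => ?_⟩
  have heq := eq_of_lipschitzJoinedIn lip₀ lip₁ hSU hsub (hρ' x₀ hx₀ x hx)
  rw [heq, ← EReal.coe_toReal (fin₀ x hx).2 (fin₀ x hx).1,
    ← EReal.coe_toReal (fin₁ x hx).2 (fin₁ x hx).1, ← EReal.coe_add, EReal.coe_eq_coe_iff]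
  simp only [quadPotential]
  ring

-- Setting `φᵢ` to `⊥` off the support preserves optimality, so `ψᵢ` is almost everywhere a
-- transform that sees only the support, where `φ₁` is a shift of `φ₀`.
open Classical in
theorem ae_eq_sub_const_of_eqOn_support [IsFiniteMeasure μ]
    (h₀ : IsDualOptimal ρ μ quadCost φ₀ ψ₀) (h₁ : IsDualOptimal ρ μ quadCost φ₁ ψ₁) {a : ℝ}
    (h : ∀ x ∈ ρ.support, φ₁ x = φ₀ x + (a : EReal)) :
    ∀ᵐ y ∂μ, ψ₁ y = ψ₀ y - (a : EReal) := by
  have restr : ∀ {φ ψ : E → EReal}, IsDualOptimal ρ μ quadCost φ ψ →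
      cTransform quadCost (fun x => if x ∈ ρ.support then φ x else ⊥) =ᵐ[μ] ψ := by
    intro φ ψ h
    refine (h.congr ?_ .rfl fun x y => ?_).symm.ae_eq_cTransform
    · filter_upwards [ρ.support_mem_ae] with x hx
      rw [if_pos hx]
    · split_ifs
      · exact h.1.add_le x y
      · simp
  have heq : (fun x => if x ∈ ρ.support then φ₁ x else ⊥) =
      fun x => (if x ∈ ρ.support then φ₀ x else ⊥) + (a : EReal) := by
    funext x
    split_ifs with hx
    · exact h x hx
    · simp
  filter_upwards [restr h₀, restr h₁] with y h2 h3
  rw [← h2, ← h3, heq, cTransform_add_const]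

end OT

theorem mainTheorem3 (d : ℕ)
    (ρ μ : Measure (EuclideanSpace ℝ (Fin d))) [IsProbabilityMeasure ρ] [IsProbabilityMeasure μ]
    (hρ : ∀ x₀ ∈ ρ.support, ∀ x₁ ∈ ρ.support,
      OT.LipschitzJoinedIn (ρ.support ∩ interior (convexHull ℝ ρ.support)) x₀ x₁)
    (φ₀ φ₁ ψ₀ ψ₁ : EuclideanSpace ℝ (Fin d) → EReal)
    (h₀ : OT.IsDualOptimal ρ μ OT.quadCost φ₀ ψ₀)
    (h₁ : OT.IsDualOptimal ρ μ OT.quadCost φ₁ ψ₁) :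
    ∃ a : ℝ,
      (∀ᵐ x ∂ρ, φ₁ x = φ₀ x + (a : EReal)) ∧
      (∀ᵐ y ∂μ, ψ₁ y = ψ₀ y - (a : EReal)) ∧
      (OT.IsCConcave (OT.quadCost (E := EuclideanSpace ℝ (Fin d))) φ₀ →
        OT.IsCConcave (OT.quadCost (E := EuclideanSpace ℝ (Fin d))) φ₁ →
        ∀ x ∈ ρ.support, φ₁ x = φ₀ x + (a : EReal)) := by
  obtain ⟨hψ₀, hφ₀, hc₀⟩ := h₀.conjugate
  obtain ⟨hψ₁, hφ₁, hc₁⟩ := h₁.conjugate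
  obtain ⟨a, ha⟩ := OT.exists_eq_add_const_of_cTransform hρ hc₀ hc₁
    (OT.upperSemicontinuous_cTransform _) (OT.upperSemicontinuous_cTransform _)
  refine ⟨a, ?_, ?_, fun hcc₀ hcc₁ x hx => ?_⟩
  · filter_upwards [hφ₀, hφ₁, ρ.support_mem_ae] with x h2 h3 hx
    rw [← h2, ← h3, ha x hx]
  · filter_upwards [hψ₀, hψ₁, OT.ae_eq_sub_const_of_eqOn_support hc₀ hc₁ ha] with y h2 h3 h4
    rw [← h2, ← h3, h4]
  -- A `c`-concave function equals its double transform everywhere, so `ha` applies pointwise.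
  · rw [← hcc₀.cTransform_cTransform, ← hcc₁.cTransform_cTransform]
    exact ha x hx
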